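/- Let $X$ be a finite set, let $\mathcal F\subseteq 2^X$ be a system of nonempty subsets of $X$, and let $G=(V,E)$ be a finite simple graph without isolated vertices that is (isomorphic to) the Kneser graph $\mathrm{KG}(\mathcal F)$, whose vertices are the sets of $\mathcal F$ and whose edges are the pairs of disjoint sets of $\mathcal F$. Notation. For $A\subseteq V$ let $\mathrm{CN}(A)=\{v\in V:\{a,v\}\in E\text{ for all }a\in A\}$. Write $A'\uplus A''=(A'\times\{1\})\cup(A''\times\{2\})$, and let $\mathrm{Box}(G)$ be the set of pairs $(A',A'')$ of disjoint subsets of $V$ (possibly empty) such that every vertex of $A'$ is adjacent to every vertex of $A''$. For a set system $\mathcal S$ let $\Delta\mathcal S$ be the order complex of $(\mathcal S\setminus\{\emptyset\},\subseteq)$, i.e. the simplicial complex of its chains. Define the simplicial complexes - $\mathsf B(G)=\{A'\uplus A'':(A',A'')\in\mathrm{Box}(G),\ \mathrm{CN}(A')\ne\emptyset,\ \mathrm{CN}(A'')\neq\emptyset\}$; - $\mathsf B_0(G)=\{A'\uplus A'':(A',A'')\in\mathrm{Box}(G)\}$; - $\mathsf B_1(G)=\Delta\{A'\uplus A'':(A',A'')\in\mathrm{Box}(G),\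 A'\neq\emptyset,\ A''\ne\emptyset\}$; - $\mathsf B_{\rm edge}(G)$, on the set of ordered pairs $(u,v)$ with $\{u,v\}\in E$, whose simplices are all subsets of the sets $A'\times A''$ with $(A',A'')\in\mathrm{Box}(G)$, $A'\ne\emptyset$, $A''\neq\emptyset$; - $\mathsf B_{\rm Sark}(\mathcal F)=\Delta\{B'\uplus B'':B',B''\subseteq X,\ B'\cap B''=\emptyset,\text{ at least one of }B',B''\text{ contains a set of }\mathcal F\}$; - $\mathsf B_1(\mathcal F)=\Delta\{B'\uplus B'':B',B''\subseteq X,\ B'\cap B''=\emptyset,\text{ both }B'\text{ and }B''\text{ contain a set of }\mathcal F\}$; - the Lovász complex $\mathsf L(G)=\Delta\{A\subseteq V: A\neq\emptyset,\ \mathrm{CN}(A)\ne\emptyset,\ \mathrm{CN}(\mathrm{CN}(A))=A\}$. Each of them carries a simplicial $\mathbb Z_2$-action: on $\mathsf L(G)$ it is given by $A\mapsto\mathrm{CN}(A)$, on $\mathsf B_{\rm edge}(G)$ by $(u,v)\mapsto(v,u)$, and on the others it is induced by interchanging the two copies of the ground set. For a simplicial complex $\mathsf K$ with such an action, let $\mathrm{ind}\,\mathsf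 K\in\{0,1,2,\dots\}\cup\{\infty\}$ be the smallest $n\ge 0$ such that there is a continuous map from the polyhedron of $\mathsf K$ to the sphere $S^n$ that commutes with the action on the polyhedron and the antipodal action $x\mapsto -x$ on $S^n$ ($\infty$ if there is no such $n$). Then $$\mathrm{ind}\,\mathsf B_1(G)=\mathrm{ind}\,\mathsf B_1(\mathcal F)=\mathrm{ind}\,\mathsf B_{\rm edge}(G)=\mathrm{ind}\,\mathsf B(G)=\mathrm{ind}\,\mathsf L(G)\le\mathrm{ind}\,\mathsf B_0(G)=\mathrm{ind}\,\mathsf B_{\rm Sark}(\mathcal F)\le\mathrm{ind}\,\mathsf B_1(G)+1 .$$ -/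

import Mathlib

/-! ### `ℤ₂`-spaces and the `ℤ₂`-index -/

/-- A `ℤ₂`-action on a topological space: a homeomorphism `ν` with `ν ∘ ν = id`. -/
structure Z2Action (T : Type*) [TopologicalSpace T] where
  toHomeomorph : T ≃ₜ T
  involutive : Function.Involutive toHomeomorph

/-- A continuous map that commutes with the `ℤ₂`-actions. -/
def IsZ2Map {T₁ T₂ : Type*} [TopologicalSpace T₁] [TopologicalSpace T₂]
    (ν₁ : Z2Action T₁) (ν₂ : Z2Action T₂) (f : T₁ → T₂) : Prop :=
  Continuous f ∧ ∀ x, f (ν₁.toHomeomorph x) = ν₂.toHomeomorph (f x)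

/-- The unit sphere `S^n` in `ℝ^(n+1)`. -/
abbrev UnitSphere (n : ℕ) : Type :=
  Metric.sphere (0 : EuclideanSpace ℝ (Fin (n + 1))) 1

/-- The antipodal action `x ↦ -x` on `S^n`. -/
noncomputable def antipodalAction (n : ℕ) : Z2Action (UnitSphere n) where
  toHomeomorph := Homeomorph.neg (UnitSphere n)
  involutive := fun x => neg_neg x

/-- The `ℤ₂`-index of `(T, ν)`: the least `n ≥ 0` for which there is a `ℤ₂`-map `T → S^n`,
and `⊤` if there is no such `n`. -/
noncomputable def z2Index {T : Type*} [TopologicalSpace T] (ν : Z2Action T) : ℕ∞ :=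
  sInf {m : ℕ∞ | ∃ n : ℕ, m = n ∧ ∃ f : T → UnitSphere n, IsZ2Map ν (antipodalAction n) f}

/-! ### Simplicial `ℤ₂`-complexes and their polyhedra -/

/-- A simplicial complex with vertices in `ι` (only the nonempty simplices are recorded),
together with an involution of the vertices that maps simplices to simplices. -/
structure Z2Complex (ι : Type*) extends PreAbstractSimplicialComplex ι where
  swap : Equiv.Perm ι
  swap_swap : ∀ v, swap (swap v) = v
  map_swap_mem : ∀ s ∈ faces, s.map swap.toEmbedding ∈ faces

namespace Z2Complex

variable {ι : Type*} (K : Z2Complex ι)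

/-- The polyhedron of `K` in barycentric coordinates, as a subspace of `ι → ℝ`. All complexes
considered here are finite, so that this is the usual topology. -/
def polyhedron : Set (ι → ℝ) :=
  {x | (∀ v, 0 ≤ x v) ∧ ∃ s ∈ K.faces, (∀ v, v ∉ s → x v = 0) ∧ ∑ v ∈ s, x v = 1}

theorem comp_swap_mem {x : ι → ℝ} (hx : x ∈ K.polyhedron) :
    (fun v => x (K.swap v)) ∈ K.polyhedron := by
  obtain ⟨h0, s, hs, hsupp, hsum⟩ := hx
  refine ⟨fun v => h0 _, s.map K.swap.toEmbedding, K.map_swap_mem s hs, ?_, ?_⟩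
  · intro v hv
    apply hsupp
    intro h
    apply hv
    rw [Finset.mem_map]
    exact ⟨K.swap v, h, K.swap_swap v⟩
  · rw [Finset.sum_map, ← hsum]
    exact Finset.sum_congr rfl fun v _ => congrArg x (K.swap_swap v)

theorem continuous_comp_swap : Continuous fun x : K.polyhedron =>
    (⟨fun v => x.1 (K.swap v), K.comp_swap_mem x.2⟩ : K.polyhedron) :=
  continuous_induced_rng.2
    (continuous_pi fun v => (continuous_apply (K.swap v)).comp continuous_subtype_val)

/-- The affine extension of the vertex involution to the polyhedron. -/
def polyhedronAction : Z2Action K.polyhedron where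
  toHomeomorph :=
    { toFun := fun x => ⟨fun v => x.1 (K.swap v), K.comp_swap_mem x.2⟩
      invFun := fun x => ⟨fun v => x.1 (K.swap v), K.comp_swap_mem x.2⟩
      left_inv := fun x => Subtype.ext (funext fun v => congrArg x.1 (K.swap_swap v))
      right_inv := fun x => Subtype.ext (funext fun v => congrArg x.1 (K.swap_swap v))
      continuous_toFun := K.continuous_comp_swap
      continuous_invFun := K.continuous_comp_swap }
  involutive := fun x => Subtype.ext (funext fun v => congrArg x.1 (K.swap_swap v))

/-- The `ℤ₂`-index of the polyhedron of `K`. -/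
noncomputable def ind : ℕ∞ := z2Index K.polyhedronAction

end Z2Complex

/-- The order complex of `P`: its simplices are the nonempty finite chains. The involution
has to preserve comparability (it may reverse the order). -/
def orderZ2Complex {P : Type*} [PartialOrder P] (ν : P → P) (hν : ∀ a, ν (ν a) = a)
    (hc : ∀ a b, a ≤ b → ν a ≤ ν b ∨ ν b ≤ ν a) : Z2Complex P where
  faces := {s | s.Nonempty ∧ IsChain (· ≤ ·) (s : Set P)}
  isRelLowerSet_faces := fun _ hs =>
    ⟨hs.1, fun _ hts ht => ⟨ht, hs.2.mono (Finset.coe_subset.2 hts)⟩⟩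
  swap := ⟨ν, ν, hν, hν⟩
  swap_swap := hν
  map_swap_mem := by
    rintro s ⟨hne, hs⟩
    refine ⟨hne.map, ?_⟩
    intro a ha b hb _
    simp only [Finset.coe_map, Set.mem_image, Finset.mem_coe] at ha hb
    obtain ⟨a, ha, rfl⟩ := ha
    obtain ⟨b, hb, rfl⟩ := hb
    rcases hs.total ha hb with h | h
    · exact hc a b h
    · exact (hc b a h).symm

/-! ### Pairs of subsets

A pair `A' ⊎ A''` of finite subsets of `α` is a finset `S` of the disjoint union `α ⊕ α` of two
copies of `α`, with `A' = S.toLeft` and `A'' = S.toRight`. -/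

/-- Interchange the shores: `A' ⊎ A'' ↦ A'' ⊎ A'`. -/
def swapShores {α : Type*} (S : Finset (α ⊕ α)) : Finset (α ⊕ α) :=
  S.map (Equiv.sumComm α α).toEmbedding

section swapShores

variable {α : Type*}

theorem toLeft_swapShores (S : Finset (α ⊕ α)) : (swapShores S).toLeft = S.toRight := by
  ext a
  simp [swapShores]

theorem toRight_swapShores (S : Finset (α ⊕ α)) : (swapShores S).toRight = S.toLeft := by
  ext a
  simp [swapShores]

theorem swapShores_swapShores (S : Finset (α ⊕ α)) : swapShores (swapShores S) = S := by
  ext (a | a) <;> simp [swapShores]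

end swapShores

/-- `Δ{A' ⊎ A'' : p A' A''}` with the action that interchanges the shores; the vertices are the
nonempty `A' ⊎ A''` with the symmetric property `p`, ordered by inclusion. -/
def pairOrderComplex {α : Type*} (p : Finset α → Finset α → Prop)
    (hp : ∀ A B, p A B → p B A) :
    Z2Complex {S : Finset (α ⊕ α) // S.Nonempty ∧ p S.toLeft S.toRight} :=
  orderZ2Complex
    (fun S => ⟨swapShores S.1, S.2.1.map, by
      rw [toLeft_swapShores, toRight_swapShores]; exact hp _ _ S.2.2⟩)
    (fun S => Subtype.ext (swapShores_swapShores S.1))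
    (fun _ _ h => Or.inl (Finset.map_subset_map.2 h))

/-- The complex `{A' ⊎ A'' : p A' A''}` for a symmetric hereditary property `p`, with the action
that interchanges the two copies of `α`. -/
def pairComplex {α : Type*} (p : Finset α → Finset α → Prop)
    (hp : ∀ A B, p A B → p B A)
    (hmono : ∀ A B A₁ B₁, A₁ ⊆ A → B₁ ⊆ B → p A B → p A₁ B₁) : Z2Complex (α ⊕ α) where
  faces := {S | S.Nonempty ∧ p S.toLeft S.toRight}
  isRelLowerSet_faces := fun _ hs =>
    ⟨hs.1, fun _ hts ht => ⟨ht, hmono _ _ _ _ (Finset.toLeft_subset_toLeft hts)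
      (Finset.toRight_subset_toRight hts) hs.2⟩⟩
  swap := Equiv.sumComm α α
  swap_swap := fun v => Sum.swap_swap v
  map_swap_mem := by
    rintro S ⟨hne, hS⟩
    refine ⟨hne.map, ?_⟩
    change p (swapShores S).toLeft (swapShores S).toRight
    rw [toLeft_swapShores, toRight_swapShores]
    exact hp _ _ hS

/-! ### Kneser graphs and box complexes -/

/-- The Kneser graph of a set system `F` on `X`: the vertices are the members of `F`, the edges
are the pairs of (distinct) disjoint members. -/
def kneserGraph {X : Type*} (F : Set (Finset X)) : SimpleGraph F where
  Adj A B := A ≠ B ∧ Disjoint A.1 B.1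
  symm := ⟨fun _ _ h => ⟨h.1.symm, h.2.symm⟩⟩
  loopless := ⟨fun _ h => h.1 rfl⟩

namespace SimpleGraph

variable {V : Type*} (G : SimpleGraph V)

/-- `CN(A)`: the set of common neighbours of `A`; in particular `CN(∅) = V`. -/
def CN (A : Set V) : Set V := {v | ∀ a ∈ A, G.Adj a v}

theorem CN_anti {A B : Set V} (h : A ⊆ B) : G.CN B ⊆ G.CN A :=
  fun _ hv a ha => hv a (h ha)

/-- `A'` and `A''` are disjoint and the bipartite graph `G[A', A'']` is complete. -/
def IsBox (A' A'' : Finset V) : Prop :=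
  Disjoint A' A'' ∧ ∀ a ∈ A', ∀ b ∈ A'', G.Adj a b

variable {G} in
theorem IsBox.symm {A B : Finset V} (h : G.IsBox A B) : G.IsBox B A :=
  ⟨h.1.symm, fun a ha b hb => (h.2 b hb a ha).symm⟩

variable {G} in
theorem IsBox.mono {A B A₁ B₁ : Finset V} (hA : A₁ ⊆ A) (hB : B₁ ⊆ B) (h : G.IsBox A B) :
    G.IsBox A₁ B₁ :=
  ⟨h.1.mono hA hB, fun a ha b hb => h.2 a (hA ha) b (hB hb)⟩

/-- The box complex `B(G)`. -/
def boxComplex : Z2Complex (V ⊕ V) :=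
  pairComplex
    (fun A' A'' => G.IsBox A' A'' ∧
      (G.CN (A' : Set V)).Nonempty ∧ (G.CN (A'' : Set V)).Nonempty)
    (fun _ _ h => ⟨h.1.symm, h.2.2, h.2.1⟩)
    (fun _ _ _ _ hA hB h => ⟨h.1.mono hA hB, h.2.1.mono (G.CN_anti (Finset.coe_subset.2 hA)),
      h.2.2.mono (G.CN_anti (Finset.coe_subset.2 hB))⟩)

/-- The box complex `B₀(G)`. -/
def boxComplexZero : Z2Complex (V ⊕ V) :=
  pairComplex G.IsBox (fun _ _ h => h.symm) (fun _ _ _ _ hA hB h => h.mono hA hB)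

/-- The box complex `B₁(G)`: the order complex of the boxes with two nonempty shores. -/
def boxComplexOne :
    Z2Complex {S : Finset (V ⊕ V) // S.Nonempty ∧
      (S.toLeft.Nonempty ∧ S.toRight.Nonempty ∧ G.IsBox S.toLeft S.toRight)} :=
  pairOrderComplex
    (fun A' A'' => A'.Nonempty ∧ A''.Nonempty ∧ G.IsBox A' A'')
    (fun _ _ h => ⟨h.2.1, h.1, h.2.2.symm⟩)

/-- The box complex `B_edge(G)` on the directed edges of `G`; the action reverses the edges. -/
def boxComplexEdge : Z2Complex G.Dart where
  faces := {D | D.Nonempty ∧ ∃ A' A'' : Finset V, A'.Nonempty ∧ A''.Nonempty ∧ G.IsBox A' A'' ∧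
    ∀ d ∈ D, d.fst ∈ A' ∧ d.snd ∈ A''}
  isRelLowerSet_faces := fun _ hs => ⟨hs.1, fun _ hts ht => by
    obtain ⟨-, A', A'', h₁, h₂, h₃, h₄⟩ := hs
    exact ⟨ht, A', A'', h₁, h₂, h₃, fun d hd => h₄ d (hts hd)⟩⟩
  swap := ⟨Dart.symm, Dart.symm, Dart.symm_symm, Dart.symm_symm⟩
  swap_swap := Dart.symm_symm
  map_swap_mem := by
    rintro D ⟨hne, A', A'', h₁, h₂, h₃, h₄⟩
    refine ⟨hne.map, A'', A', h₂, h₁, h₃.symm, ?_⟩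
    intro d hd
    obtain ⟨d₀, hd₀, rfl⟩ := Finset.mem_map.1 hd
    exact ⟨(h₄ d₀ hd₀).2, (h₄ d₀ hd₀).1⟩

/-- The Lovász complex `L(G)`: the order complex of the system of nonempty sets `A` with a common
neighbour that are closed, `CN(CN(A)) = A`; the action is `A ↦ CN(A)`. -/
def lovaszComplex :
    Z2Complex {A : Set V // A.Nonempty ∧ (G.CN A).Nonempty ∧ G.CN (G.CN A) = A} :=
  orderZ2Complex
    (fun A => ⟨G.CN A.1, A.2.2.1, by rw [A.2.2.2]; exact A.2.1, by rw [A.2.2.2]⟩)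
    (fun A => Subtype.ext A.2.2.2)
    (fun _ _ h => Or.inr (G.CN_anti h))

end SimpleGraph

section SetSystem

variable {X : Type*} (F : Set (Finset X))

/-- The Sarkaria complex `B_Sark(F)`: the order complex of the disjoint pairs `B' ⊎ B''` such that
at least one of `B'`, `B''` contains a set of `F`. -/
def sarkariaComplex :
    Z2Complex {S : Finset (X ⊕ X) // S.Nonempty ∧
      (Disjoint S.toLeft S.toRight ∧ ((∃ A ∈ F, A ⊆ S.toLeft) ∨ ∃ A ∈ F, A ⊆ S.toRight))} :=
  pairOrderComplex
    (fun B' B'' => Disjoint B' B'' ∧ ((∃ A ∈ F, A ⊆ B') ∨ ∃ A ∈ F, A ⊆ B''))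
    (fun _ _ h => ⟨h.1.symm, h.2.symm⟩)

/-- The Kneser box complex `B₁(F)`: the order complex of the disjoint pairs `B' ⊎ B''` such that
both `B'` and `B''` contain a set of `F`. -/
def kneserBoxComplexOne :
    Z2Complex {S : Finset (X ⊕ X) // S.Nonempty ∧
      (Disjoint S.toLeft S.toRight ∧ (∃ A ∈ F, A ⊆ S.toLeft) ∧ ∃ A ∈ F, A ⊆ S.toRight)} :=
  pairOrderComplex
    (fun B' B'' => Disjoint B' B'' ∧ (∃ A ∈ F, A ⊆ B') ∧ ∃ A ∈ F, A ⊆ B'')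
    (fun _ _ h => ⟨h.1.symm, h.2.2, h.2.1⟩)

end SetSystem

/-! ### Comparing indices by equivariant maps -/

/-! An equivariant map K → L gives ind K ≤ ind L by composition with a map to a sphere. The
equalities therefore need only ℤ₂-maps in both directions, not ℤ₂-homotopy equivalences. Most maps
are combinatorial: a relation on vertices that carries simplices into simplices is averaged and
extended affinely (`hasZ2Map_of_rel`), and `sd_hasZ2Map` and `hasZ2Map_sd` allow passage to the
barycentric subdivision and back. For order complexes, comparable elements only need comparable
values (`hasZ2Map_of_chain_rel`).

For the graph complexes, B₁ → B → L → B₁ is a cycle of ℤ₂-maps, B₁ and B_edge exchange a box with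
its set of directed edges, and B₁ includes into B₀. For the set system, taking the union of a family
of vertices and, conversely, all members of F inside a subset of X gives monotone maps that turn
boxes into disjoint pairs and back. These relate B₁(G) to B₁(F) and B₀(G) to B_Sark(F).

The last inequality is a suspension argument (`ind_le_ind_add_one`): in sd B₀, the simplices outside
B₁ have one empty shore, and no chain contains both kinds of them. This gives one extra signed
coordinate, so a ℤ₂-map B₁ → S^n produces a ℤ₂-map B₀ → S^(n+1). -/

namespace Z2Complex

variable {ι κ μ : Type*}

/-- There is a `ℤ₂`-map between the polyhedra of `K` and `L`. -/
def HasZ2Map (K : Z2Complex ι) (L : Z2Complex κ) : Prop :=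
  ∃ f : K.polyhedron → L.polyhedron, IsZ2Map K.polyhedronAction L.polyhedronAction f

theorem HasZ2Map.trans {K : Z2Complex ι} {L : Z2Complex κ} {M : Z2Complex μ}
    (h₁ : K.HasZ2Map L) (h₂ : L.HasZ2Map M) : K.HasZ2Map M := by
  obtain ⟨f, hf, hf'⟩ := h₁
  obtain ⟨g, hg, hg'⟩ := h₂
  exact ⟨g ∘ f, hg.comp hf, fun x => by simp only [Function.comp, hf', hg']⟩

theorem HasZ2Map.ind_le {K : Z2Complex ι} {L : Z2Complex κ} (h : K.HasZ2Map L) :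
    K.ind ≤ L.ind := by
  obtain ⟨f, hf, hf'⟩ := h
  refine sInf_le_sInf ?_
  rintro _ ⟨n, rfl, g, hg, hg'⟩
  exact ⟨n, rfl, g ∘ f, hg.comp hf, fun x => by simp only [Function.comp, hf', hg']⟩

theorem polyhedronAction_apply (K : Z2Complex ι) (x : K.polyhedron) (v : ι) :
    (K.polyhedronAction.toHomeomorph x).1 v = x.1 (K.swap v) := rfl

theorem exists_pos_of_sum_eq_one {s : Finset ι} {x : ι → ℝ}
    (h0 : ∀ v, 0 ≤ x v) (hsum : ∑ v ∈ s, x v = 1) : ∃ v ∈ s, 0 < x v := by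
  by_contra! h
  have : ∑ v ∈ s, x v = 0 := Finset.sum_eq_zero fun v hv => le_antisymm (h v hv) (h0 v)
  linarith

/-- Continuous equivariant nonnegative weights on the vertices of `L`, supported on simplices and
not all zero, give a `ℤ₂`-map into the polyhedron of `L` after normalisation. -/
theorem hasZ2Map_of_weights [Fintype κ] (K : Z2Complex ι) (L : Z2Complex κ)
    (W : K.polyhedron → κ → ℝ) (hc : ∀ k, Continuous fun x => W x k)
    (h0 : ∀ x k, 0 ≤ W x k) (hpos : ∀ x, ∃ k, W x k ≠ 0)
    (hsupp : ∀ x, ∃ s ∈ L.faces, ∀ k, k ∉ s → W x k = 0)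
    (hν : ∀ x k, W (K.polyhedronAction.toHomeomorph x) k = W x (L.swap k)) :
    K.HasZ2Map L := by
  have hsum : ∀ x, 0 < ∑ k, W x k := fun x => by
    obtain ⟨k, hk⟩ := hpos x
    exact Finset.sum_pos' (fun k _ => h0 x k)
      ⟨k, Finset.mem_univ _, lt_of_le_of_ne (h0 x k) hk.symm⟩
  refine ⟨fun x => ⟨fun k => W x k / ∑ k, W x k,
    fun k => div_nonneg (h0 x k) (hsum x).le, ?_⟩, ?_, ?_⟩
  · obtain ⟨s, hs, h⟩ := hsupp x
    refine ⟨s, hs, fun k hk => by simp only [h k hk, zero_div], ?_⟩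
    rw [← Finset.sum_div, Finset.sum_subset (Finset.subset_univ s) fun k _ hk => h k hk,
      div_self (hsum x).ne']
  · refine continuous_induced_rng.2 (continuous_pi fun k => ?_)
    exact (hc k).div (continuous_finsetSum _ fun k _ => hc k) fun x => (hsum x).ne'
  · intro x
    refine Subtype.ext (funext fun k => ?_)
    rw [polyhedronAction_apply]
    simp only [hν]
    rw [Equiv.sum_comp L.swap (fun k => W x k)]

/-- An equivariant multivalued map on the vertices which carries simplices to simplices gives
a `ℤ₂`-map of polyhedra: each vertex goes to the barycentre of its values. -/
theorem hasZ2Map_of_rel [Finite ι] [Finite κ] (K : Z2Complex ι) (L : Z2Complex κ)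
    (R : ι → κ → Prop) (hR : ∀ i k, R i k → R (K.swap i) (L.swap k))
    (htot : ∀ i, ∃ k, R i k)
    (hface : ∀ s ∈ K.faces, ∃ t ∈ L.faces, ∀ i ∈ s, ∀ k, R i k → k ∈ t) :
    K.HasZ2Map L := by
  classical
  have := Fintype.ofFinite ι
  have := Fintype.ofFinite κ
  have hR' : ∀ i k, R (K.swap i) k ↔ R i (L.swap k) := fun i k =>
    ⟨fun h => by simpa only [K.swap_swap] using hR _ _ h,
      fun h => by simpa only [L.swap_swap] using hR _ _ h⟩
  have hnn : ∀ (x : K.polyhedron) i k, 0 ≤ x.1 i * (if R i k then 1 else 0) := fun x i k =>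
    mul_nonneg (x.2.1 i) (by split_ifs <;> norm_num)
  refine hasZ2Map_of_weights K L (fun x k => ∑ i, x.1 i * (if R i k then 1 else 0)) ?_ ?_ ?_ ?_ ?_
  · intro k
    exact continuous_finsetSum _ fun i _ =>
      ((continuous_apply i).comp continuous_subtype_val).mul continuous_const
  · exact fun x k => Finset.sum_nonneg fun i _ => hnn x i k
  · intro x
    obtain ⟨s, hs, h, hsum⟩ := x.2.2
    obtain ⟨i, -, hi⟩ := exists_pos_of_sum_eq_one x.2.1 hsum
    obtain ⟨k, hk⟩ := htot i
    refine ⟨k, (Finset.sum_pos' (fun i _ => hnn x i k) ⟨i, Finset.mem_univ _, ?_⟩).ne'⟩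
    simpa [hk] using hi
  · intro x
    obtain ⟨s, hs, h, hsum⟩ := x.2.2
    obtain ⟨t, ht, hst⟩ := hface s hs
    refine ⟨t, ht, fun k hk => Finset.sum_eq_zero fun i _ => ?_⟩
    by_cases hi : i ∈ s
    · rw [if_neg fun hik => hk (hst i hi k hik), mul_zero]
    · rw [h i hi, zero_mul]
  · intro x k
    simp only [polyhedronAction_apply]
    rw [← Equiv.sum_comp K.swap]
    refine Finset.sum_congr rfl fun i _ => ?_
    simp only [K.swap_swap, hR']

/-- The barycentric subdivision. -/
def sd (K : Z2Complex ι) : Z2Complex {s : Finset ι // s ∈ K.faces} :=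
  orderZ2Complex (fun s => ⟨s.1.map K.swap.toEmbedding, K.map_swap_mem _ s.2⟩)
    (fun s => Subtype.ext (by
      ext v
      simp only [Finset.mem_map_equiv]
      rw [show K.swap.symm (K.swap.symm v) = v by
        rw [Equiv.symm_apply_eq, Equiv.symm_apply_eq, K.swap_swap]]))
    (fun _ _ h => Or.inl (Finset.map_subset_map.2 h))

theorem coe_sd_swap (K : Z2Complex ι) (s : {s : Finset ι // s ∈ K.faces}) :
    (K.sd.swap s).1 = s.1.map K.swap.toEmbedding := rfl

/-- Each simplex goes to its barycentre; all simplices of a chain lie in the largest one. -/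
theorem sd_hasZ2Map [Finite ι] (K : Z2Complex ι) : K.sd.HasZ2Map K := by
  classical
  refine hasZ2Map_of_rel _ _ (fun s v => v ∈ s.1) ?_ ?_ ?_
  · intro s v hv
    rw [coe_sd_swap]
    exact Finset.mem_map_of_mem _ hv
  · exact fun s => (K.isRelLowerSet_faces s.2).1
  · rintro c ⟨hne, hc⟩
    obtain ⟨m, hm⟩ := c.exists_maximal hne
    refine ⟨m.1, m.2, fun s hs v hv => ?_⟩
    rcases hc.total hs hm.1 with h | h
    · exact h hv
    · exact hm.2 hs h hv

/-- The simplices with positive weight are those that are cut out from the support of a point by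
a threshold for the barycentric coordinates. -/
theorem hasZ2Map_sd [Finite ι] (K : Z2Complex ι) : K.HasZ2Map K.sd := by
  classical
  have := Fintype.ofFinite ι
  have := Fintype.ofFinite {s : Finset ι // s ∈ K.faces}
  let W : (ι → ℝ) → Finset ι → ℝ := fun x s =>
    ∏ v ∈ s, (x v * ∏ u, if u ∈ s then 1 else max 0 (x v - x u))
  have hW : ∀ x s, W x s ≠ 0 → ∀ v ∈ s, ∀ u, u ∉ s → x u < x v := by
    intro x s h v hv u hu
    have h₁ := Finset.prod_ne_zero_iff.1 (right_ne_zero_of_mul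
      (Finset.prod_ne_zero_iff.1 h v hv)) u (Finset.mem_univ _)
    rw [if_neg hu] at h₁
    by_contra! hle
    exact h₁ (max_eq_left (by linarith))
  have hpos : ∀ x : K.polyhedron, ∃ s : {s : Finset ι // s ∈ K.faces}, W x.1 s.1 ≠ 0 := by
    intro x
    obtain ⟨s, hs, h, hsum⟩ := x.2.2
    obtain ⟨i, his, hi⟩ := exists_pos_of_sum_eq_one x.2.1 hsum
    -- The full support of `x` always has positive weight: its coordinates are positive and exceed
    -- the zeros outside it.
    refine ⟨⟨s.filter fun v => 0 < x.1 v, (K.isRelLowerSet_faces hs).2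
      (Finset.filter_subset _ _) ⟨i, Finset.mem_filter.2 ⟨his, hi⟩⟩⟩, ?_⟩
    refine Finset.prod_ne_zero_iff.2 fun v hv => mul_ne_zero (Finset.mem_filter.1 hv).2.ne'
      (Finset.prod_ne_zero_iff.2 fun u _ => ?_)
    have hv0 := (Finset.mem_filter.1 hv).2
    split_ifs with hu
    · exact one_ne_zero
    · have hu0 : x.1 u ≤ 0 := by
        by_cases hus : u ∈ s
        · by_contra! hlt
          exact hu (Finset.mem_filter.2 ⟨hus, hlt⟩)
        · exact (h u hus).le
      exact (lt_max_of_lt_right (by linarith)).ne'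
  refine hasZ2Map_of_weights K K.sd (fun x s => W x.1 s.1) ?_ ?_ ?_ ?_ ?_
  · intro s
    have hx : ∀ v, Continuous fun x : K.polyhedron => x.1 v := fun v =>
      (continuous_apply v).comp continuous_subtype_val
    refine continuous_finsetProd _ fun v _ => (hx v).mul (continuous_finsetProd _ fun u _ => ?_)
    split_ifs
    · exact continuous_const
    · exact continuous_const.max ((hx v).sub (hx u))
  · intro x s
    refine Finset.prod_nonneg fun v _ => mul_nonneg (x.2.1 v) (Finset.prod_nonneg fun u _ => ?_)
    split_ifs
    · exact zero_le_one
    · exact le_max_left _ _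
  · exact hpos
  · intro x
    refine ⟨Finset.univ.filter fun s => W x.1 s.1 ≠ 0, ⟨?_, ?_⟩, ?_⟩
    · obtain ⟨s, hs⟩ := hpos x
      exact ⟨s, Finset.mem_filter.2 ⟨Finset.mem_univ _, hs⟩⟩
    · intro s hs t ht _
      have hs' := hW _ _ (Finset.mem_filter.1 (Finset.mem_coe.1 hs)).2
      have ht' := hW _ _ (Finset.mem_filter.1 (Finset.mem_coe.1 ht)).2
      -- With `v` in `s` but not in `t`, and `u` in `t` but not in `s`, the thresholds would force
      -- both `x u < x v` and `x v < x u`.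
      by_contra! hst
      obtain ⟨v, hvs, hvt⟩ := Finset.not_subset.1 hst.1
      obtain ⟨u, hut, hus⟩ := Finset.not_subset.1 hst.2
      exact lt_asymm (hs' v hvs u hus) (ht' u hut v hvt)
    · intro s hs
      by_contra h
      exact hs (Finset.mem_filter.2 ⟨Finset.mem_univ _, h⟩)
  · intro x s
    simp only [W, coe_sd_swap, polyhedronAction_apply, Finset.prod_map]
    refine Finset.prod_congr rfl fun v _ => ?_
    congr 1
    rw [← Equiv.prod_comp K.swap]
    refine Finset.prod_congr rfl fun u _ => ?_
    simp only [K.swap_swap, Finset.mem_map_equiv, Equiv.coe_toEmbedding]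
    rw [show K.swap.symm u = K.swap u by rw [Equiv.symm_apply_eq, K.swap_swap]]

end Z2Complex

/-! ### Maps between order complexes -/

open Z2Complex

section OrderComplex

variable {P Q : Type*} [PartialOrder P] [PartialOrder Q]

/-- The values on a chain together form a chain. The case `a = b` of `hcomp` makes the values at a
single element comparable. Order reversal is allowed because the action on the Lovász complex is
antitone. -/
theorem hasZ2Map_of_chain_rel [Finite P] [Finite Q] {K : Z2Complex P} {L : Z2Complex Q}
    (hK : ∀ s ∈ K.faces, IsChain (· ≤ ·) (s : Set P))
    (hL : ∀ s : Finset Q, s.Nonempty → IsChain (· ≤ ·) (s : Set Q) → s ∈ L.faces)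
    (R : P → Q → Prop)
    (hR : ∀ a p, R a p → R (K.swap a) (L.swap p)) (htot : ∀ a, ∃ p, R a p)
    (hcomp : ∀ a b, a ≤ b → ∀ p q, R a p → R b q → p ≤ q ∨ q ≤ p) :
    K.HasZ2Map L := by
  classical
  have := Fintype.ofFinite Q
  refine hasZ2Map_of_rel _ _ R hR htot fun s hs => ?_
  refine ⟨Finset.univ.filter fun p => ∃ a ∈ s, R a p, hL _ ?_ ?_, fun a ha p hp =>
    Finset.mem_filter.2 ⟨Finset.mem_univ _, a, ha, hp⟩⟩
  · obtain ⟨a, ha⟩ := (K.isRelLowerSet_faces hs).1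
    obtain ⟨p, hp⟩ := htot a
    exact ⟨p, Finset.mem_filter.2 ⟨Finset.mem_univ _, a, ha, hp⟩⟩
  · intro p hp q hq _
    obtain ⟨-, a, ha, hap⟩ := Finset.mem_filter.1 (Finset.mem_coe.1 hp)
    obtain ⟨-, b, hb, hbq⟩ := Finset.mem_filter.1 (Finset.mem_coe.1 hq)
    rcases (hK s hs).total ha hb with h | h
    · exact hcomp a b h p q hap hbq
    · exact (hcomp b a h q p hbq hap).symm

theorem hasZ2Map_of_chain_map [Finite P] [Finite Q] {K : Z2Complex P} {L : Z2Complex Q}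
    (hK : ∀ s ∈ K.faces, IsChain (· ≤ ·) (s : Set P))
    (hL : ∀ s : Finset Q, s.Nonempty → IsChain (· ≤ ·) (s : Set Q) → s ∈ L.faces)
    (f : P → Q) (hf : ∀ a, f (K.swap a) = L.swap (f a))
    (hcomp : ∀ a b, a ≤ b → f a ≤ f b ∨ f b ≤ f a) :
    K.HasZ2Map L := by
  refine hasZ2Map_of_chain_rel hK hL (fun a p => p = f a) ?_ (fun a => ⟨_, rfl⟩) ?_
  · rintro a _ rfl
    exact (hf a).symm
  · rintro a b h _ _ rfl rfl
    exact hcomp a b h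

end OrderComplex

/-! ### Maps into a suspension -/

namespace Z2Complex

variable {ι κ : Type*}

/-- Suppose that the vertices of `K` outside the subcomplex `L` carry signs `±1` that are
interchanged by the action, and that no simplex has vertices of both signs. Then `K` maps to the
suspension of `L`. -/
theorem ind_le_ind_add_one [Finite ι] (K : Z2Complex ι) (L : Z2Complex κ) (j : κ ↪ ι)
    (hj : ∀ k, j (L.swap k) = K.swap (j k))
    (hface : ∀ s ∈ K.faces, ∀ t : Finset κ, t.Nonempty → (∀ k ∈ t, j k ∈ s) → t ∈ L.faces)
    (c : ι → ℝ) (hc : ∀ i, c (K.swap i) = -c i) (hc0 : ∀ i, c i = 0 → i ∈ Set.range j)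
    (hsign : ∀ s ∈ K.faces, (∀ i ∈ s, 0 ≤ c i) ∨ ∀ i ∈ s, c i ≤ 0) :
    K.ind ≤ L.ind + 1 := by
  classical
  have := Fintype.ofFinite ι
  have : Finite κ := Finite.of_injective j j.injective
  have := Fintype.ofFinite κ
  by_cases hL : L.ind = ⊤
  · rw [hL]; exact le_top
  have hmem : L.ind ∈ {m : ℕ∞ | ∃ n : ℕ, m = n ∧ ∃ f : L.polyhedron → UnitSphere n,
      IsZ2Map L.polyhedronAction (antipodalAction n) f} := by
    -- The infimum of the empty set is `⊤`, so a finite index is attained by some map.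
    refine csInf_mem (Set.nonempty_iff_ne_empty.2 fun h => hL ?_)
    rw [ind, z2Index, h, sInf_empty]
  obtain ⟨n, hn, f, hf, hfν⟩ := hmem
  rw [hn]
  -- `a` is the total weight that a point puts on the vertices of `L`. Where it is positive,
  -- restricting to `L` and dividing by `a` gives a point of the polyhedron of `L`.
  let a : K.polyhedron → ℝ := fun x => ∑ k, x.1 (j k)
  have hx : ∀ v, Continuous fun x : K.polyhedron => x.1 v := fun v =>
    (continuous_apply v).comp continuous_subtype_val
  have ha : Continuous a := continuous_finsetSum _ fun k _ => hx (j k)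
  have ha0 : ∀ x, 0 ≤ a x := fun x => Finset.sum_nonneg fun k _ => x.2.1 (j k)
  have haν : ∀ x, a (K.polyhedronAction.toHomeomorph x) = a x := fun x => by
    simp only [a, polyhedronAction_apply, ← hj]
    exact Equiv.sum_comp L.swap (fun k => x.1 (j k))
  have hy : ∀ x : K.polyhedron, 0 < a x → (fun k => x.1 (j k) / a x) ∈ L.polyhedron := by
    intro x hax
    obtain ⟨s, hs, h, -⟩ := x.2.2
    have hsum : ∑ k ∈ Finset.univ.filter (fun k => j k ∈ s), x.1 (j k) = a x :=
      Finset.sum_subset (Finset.filter_subset _ _) fun k _ hk =>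
        h _ fun hks => hk (Finset.mem_filter.2 ⟨Finset.mem_univ _, hks⟩)
    refine ⟨fun k => div_nonneg (x.2.1 _) hax.le, Finset.univ.filter (fun k => j k ∈ s),
      hface s hs _ ?_ fun k hk => (Finset.mem_filter.1 hk).2, fun k hk => ?_, ?_⟩
    · refine Finset.nonempty_iff_ne_empty.2 fun he => hax.ne ?_
      rw [← hsum, he, Finset.sum_empty]
    · simp only [h _ fun hks => hk (Finset.mem_filter.2 ⟨Finset.mem_univ _, hks⟩), zero_div]
    · rw [← Finset.sum_div, hsum, div_self hax.ne']
  -- The factor `a x` makes the norm of `g x` equal to `a x`, so that the extension by `0` is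
  -- continuous where `a` vanishes.
  let g : K.polyhedron → EuclideanSpace ℝ (Fin (n + 1)) := fun x =>
    if h : 0 < a x then a x • (f ⟨_, hy x h⟩).1 else 0
  have hgnorm : ∀ x, ‖g x‖ = a x := by
    intro x
    by_cases h : 0 < a x
    · simp only [g, dif_pos h, norm_smul, norm_eq_of_mem_sphere, mul_one, Real.norm_eq_abs,
        abs_of_pos h]
    · simp only [g, dif_neg h, norm_zero]
      exact le_antisymm (ha0 x) (not_lt.1 h)
  have hg : Continuous g := by
    refine continuous_iff_continuousAt.2 fun x => ?_
    rcases (ha0 x).eq_or_lt with h | h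
    · have hgx : g x = 0 := norm_eq_zero.1 ((hgnorm x).trans h.symm)
      rw [ContinuousAt, hgx, tendsto_zero_iff_norm_tendsto_zero]
      simp only [hgnorm]
      rw [h]
      exact ha.tendsto x
    · have hU : IsOpen {x | 0 < a x} := isOpen_lt continuous_const ha
      refine ContinuousOn.continuousAt ?_ (hU.mem_nhds h)
      rw [continuousOn_iff_continuous_domRestrict]
      have : Set.domRestrict {x | 0 < a x} g = fun x => a x.1 • (f ⟨_, hy x.1 x.2⟩).1 := by
        funext x
        exact dif_pos x.2
      rw [this]
      refine (ha.comp continuous_subtype_val).smul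
        (continuous_subtype_val.comp (hf.comp (continuous_induced_rng.2
          (continuous_pi fun k => ?_))))
      exact ((hx _).comp continuous_subtype_val).div (ha.comp continuous_subtype_val)
        fun x => x.2.ne'
  have hgν : ∀ x, g (K.polyhedronAction.toHomeomorph x) = -g x := by
    intro x
    by_cases h : 0 < a x
    · have h' : 0 < a (K.polyhedronAction.toHomeomorph x) := by rwa [haν]
      simp only [g, dif_pos h, dif_pos h', haν]
      rw [← smul_neg]
      congr 1
      refine Eq.trans ?_ (congrArg Subtype.val (hfν ⟨_, hy x h⟩))
      congr 2
      refine Subtype.ext (funext fun k => ?_)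
      simp only [polyhedronAction_apply, hj]
    · have h' : ¬ 0 < a (K.polyhedronAction.toHomeomorph x) := by rwa [haν]
      simp only [g, dif_neg h, dif_neg h', neg_zero]
  let b : K.polyhedron → ℝ := fun x => ∑ i, x.1 i * c i
  have hb : Continuous b := continuous_finsetSum _ fun i _ => (hx i).mul continuous_const
  have hbν : ∀ x, b (K.polyhedronAction.toHomeomorph x) = -b x := fun x => by
    simp only [b, polyhedronAction_apply]
    rw [← Equiv.sum_comp K.swap, ← Finset.sum_neg_distrib]
    exact Finset.sum_congr rfl fun i _ => by rw [K.swap_swap, hc, mul_neg]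
  -- On one simplex all terms of `b` have the same sign, so `b x = 0` makes each of them vanish. A
  -- vertex of positive weight then has sign `0`, lies in `L` and contributes to `a x`.
  have hab : ∀ x, a x = 0 → b x ≠ 0 := by
    intro x hax hbx
    obtain ⟨s, hs, h, hsum⟩ := x.2.2
    obtain ⟨i, his, hi⟩ := exists_pos_of_sum_eq_one x.2.1 hsum
    have hterm : x.1 i * c i = 0 := by
      rcases hsign s hs with hs' | hs'
      · refine (Finset.sum_eq_zero_iff_of_nonneg fun i _ => ?_).1 hbx i (Finset.mem_univ _)
        by_cases hi : i ∈ s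
        · exact mul_nonneg (x.2.1 i) (hs' i hi)
        · rw [h i hi, zero_mul]
      · refine (Finset.sum_eq_zero_iff_of_nonpos fun i _ => ?_).1 hbx i (Finset.mem_univ _)
        by_cases hi : i ∈ s
        · exact mul_nonpos_of_nonneg_of_nonpos (x.2.1 i) (hs' i hi)
        · rw [h i hi, zero_mul]
    obtain ⟨k, rfl⟩ := hc0 i ((mul_eq_zero.1 hterm).resolve_left hi.ne')
    exact hi.ne' ((Finset.sum_eq_zero_iff_of_nonneg fun k _ => x.2.1 (j k)).1 hax k
      (Finset.mem_univ _))
  -- The suspension coordinate `b` is put in front of `g`; the resulting odd map never vanishes and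
  -- is normalised to land in the sphere.
  let H : K.polyhedron → EuclideanSpace ℝ (Fin (n + 1 + 1)) := fun x =>
    WithLp.toLp 2 (Fin.cons (b x) (g x).ofLp : Fin (n + 1 + 1) → ℝ)
  have hH : Continuous H := by
    refine (PiLp.continuous_toLp 2 _).comp (continuous_pi fun i => ?_)
    refine Fin.cases ?_ (fun i => ?_) i
    · simpa using hb
    · simp only [Fin.cons_succ]
      exact (continuous_apply i).comp ((PiLp.continuous_ofLp 2 _).comp hg)
  have hHν : ∀ x, H (K.polyhedronAction.toHomeomorph x) = -H x := by
    intro x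
    ext i
    refine Fin.cases ?_ (fun i => ?_) i
    · simp [H, hbν]
    · simp [H, hgν]
  have hH0 : ∀ x, H x ≠ 0 := by
    intro x h0
    have hcoord : ∀ i, (Fin.cons (b x) (g x).ofLp : Fin (n + 1 + 1) → ℝ) i = 0 := fun i =>
      congrArg (fun v : EuclideanSpace ℝ (Fin (n + 1 + 1)) => v i) h0
    have hgx : g x = 0 := by
      ext i
      simpa using hcoord i.succ
    exact hab x (by rw [← hgnorm, hgx, norm_zero]) (by simpa using hcoord 0)
  refine sInf_le ⟨n + 1, by push_cast; rfl, fun x => ⟨‖H x‖⁻¹ • H x, ?_⟩, ?_, fun x => ?_⟩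
  · rw [mem_sphere_zero_iff_norm, norm_smul, norm_inv, norm_norm,
      inv_mul_cancel₀ (norm_ne_zero_iff.2 (hH0 x))]
  · exact continuous_induced_rng.2
      ((hH.norm.inv₀ fun x => norm_ne_zero_iff.2 (hH0 x)).smul hH)
  · refine Subtype.ext ?_
    change ‖_‖⁻¹ • _ = -(‖H x‖⁻¹ • H x)
    rw [hHν, norm_neg, smul_neg]

end Z2Complex

/-! ### Complexes of pairs of sets -/

section PairComplex

variable {α β : Type*}

theorem swapShores_disjSum (A B : Finset α) : swapShores (A.disjSum B) = B.disjSum A := by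
  ext (a | a) <;> simp [swapShores]

theorem toLeft_nonempty_or_toRight_nonempty {S : Finset (α ⊕ β)} (h : S.Nonempty) :
    S.toLeft.Nonempty ∨ S.toRight.Nonempty := by
  obtain ⟨a | a, ha⟩ := h
  · exact Or.inl ⟨a, Finset.mem_toLeft.2 ha⟩
  · exact Or.inr ⟨a, Finset.mem_toRight.2 ha⟩

theorem disjSum_nonempty {A : Finset α} {B : Finset β} (h : A.Nonempty ∨ B.Nonempty) :
    (A.disjSum B).Nonempty := by
  rcases h with ⟨a, ha⟩ | ⟨b, hb⟩
  · exact ⟨_, Finset.inl_mem_disjSum.2 ha⟩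
  · exact ⟨_, Finset.inr_mem_disjSum.2 hb⟩

/-- Applying the same monotone `f` to both shores commutes with interchanging them and preserves
inclusion. -/
theorem pairOrderComplex_hasZ2Map [Finite α] [Finite β]
    {p : Finset α → Finset α → Prop} {hp : ∀ A B, p A B → p B A}
    {q : Finset β → Finset β → Prop} {hq : ∀ A B, q A B → q B A}
    (f : Finset α → Finset β) (hf : Monotone f)
    (h : ∀ A B, A.Nonempty ∨ B.Nonempty → p A B →
      ((f A).Nonempty ∨ (f B).Nonempty) ∧ q (f A) (f B)) :
    (pairOrderComplex p hp).HasZ2Map (pairOrderComplex q hq) := by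
  have h' := fun S : {S : Finset (α ⊕ α) // S.Nonempty ∧ p S.toLeft S.toRight} =>
    h _ _ (toLeft_nonempty_or_toRight_nonempty S.2.1) S.2.2
  refine hasZ2Map_of_chain_map (fun _ h => h.2)
    (fun _ h₁ h₂ => ⟨h₁, h₂⟩)
    (fun S => ⟨(f S.1.toLeft).disjSum (f S.1.toRight), disjSum_nonempty (h' S).1, by
      rw [Finset.toLeft_disjSum, Finset.toRight_disjSum]; exact (h' S).2⟩) ?_ ?_
  · intro S
    refine Subtype.ext ?_
    change (f (swapShores S.1).toLeft).disjSum (f (swapShores S.1).toRight) =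
      swapShores ((f S.1.toLeft).disjSum (f S.1.toRight))
    rw [toLeft_swapShores, toRight_swapShores, swapShores_disjSum]
  · intro S T hST
    exact Or.inl (Finset.disjSum_mono (hf (Finset.toLeft_subset_toLeft hST))
      (hf (Finset.toRight_subset_toRight hST)))

/-- By definition the order complex is the barycentric subdivision of the pair complex, since its
elements are exactly the simplices. -/
theorem pairComplex_hasZ2Map_pairOrderComplex [Finite α] {p : Finset α → Finset α → Prop}
    {hp hmono} : (pairComplex p hp hmono).HasZ2Map (pairOrderComplex p hp) :=
  hasZ2Map_sd (pairComplex p hp hmono)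

theorem pairOrderComplex_hasZ2Map_pairComplex [Finite α] {p : Finset α → Finset α → Prop}
    {hp hmono} : (pairOrderComplex p hp).HasZ2Map (pairComplex p hp hmono) :=
  sd_hasZ2Map (pairComplex p hp hmono)

end PairComplex

/-! ### Box complexes of a graph -/

namespace SimpleGraph

variable {V : Type*} (G : SimpleGraph V)

theorem finite_dart [Finite V] : Finite G.Dart :=
  Finite.of_injective _ Dart.toProd_injective

theorem subset_CN_comm {A B : Set V} : A ⊆ G.CN B ↔ B ⊆ G.CN A :=
  ⟨fun h _ hb _ ha => (h ha _ hb).symm, fun h _ ha _ hb => (h hb _ ha).symm⟩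

theorem subset_CN_CN (A : Set V) : A ⊆ G.CN (G.CN A) := G.subset_CN_comm.1 subset_rfl

theorem CN_CN_CN (A : Set V) : G.CN (G.CN (G.CN A)) = G.CN A :=
  (G.CN_anti (G.subset_CN_CN A)).antisymm (G.subset_CN_CN _)

-- Disjointness of the shores is automatic, because no vertex is adjacent to itself.
variable {G} in
theorem isBox_iff_subset_CN {A B : Finset V} : G.IsBox A B ↔ (B : Set V) ⊆ G.CN A := by
  refine ⟨fun h b hb a ha => h.2 a ha b hb, fun h => ⟨?_, fun a ha b hb => h hb a ha⟩⟩
  rw [Finset.disjoint_left]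
  exact fun a ha hb => G.irrefl (h hb a ha)

/-- A simplex `D` of directed edges goes to the box formed by its initial and terminal vertices;
this is a box because it lies inside the box that contains `D`. -/
theorem boxComplexEdge_hasZ2Map_boxComplexOne [Finite V] :
    G.boxComplexEdge.HasZ2Map G.boxComplexOne := by
  classical
  have := G.finite_dart
  have key : ∀ D ∈ G.boxComplexEdge.faces, G.IsBox (D.image fun d => d.fst) (D.image fun d => d.snd) := by
    rintro D ⟨-, A, B, -, -, h, hD⟩
    refine h.mono ?_ ?_
    · exact Finset.image_subset_iff.2 fun d hd => (hD d hd).1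
    · exact Finset.image_subset_iff.2 fun d hd => (hD d hd).2
  refine G.boxComplexEdge.hasZ2Map_sd.trans (hasZ2Map_of_chain_map (fun _ h => h.2)
    (fun _ h₁ h₂ => ⟨h₁, h₂⟩)
    (fun D => ⟨(D.1.image fun d => d.fst).disjSum (D.1.image fun d => d.snd),
      disjSum_nonempty (Or.inl (D.2.1.image _)), ?_⟩) ?_ ?_)
  · rw [Finset.toLeft_disjSum, Finset.toRight_disjSum]
    exact ⟨D.2.1.image _, D.2.1.image _, key D.1 D.2⟩
  · intro D
    refine Subtype.ext ?_
    refine Eq.trans ?_ (swapShores_disjSum _ _).symm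
    change ((D.1.map G.boxComplexEdge.swap.toEmbedding).image fun d => d.fst).disjSum
      ((D.1.map G.boxComplexEdge.swap.toEmbedding).image fun d => d.snd) = _
    rw [Finset.map_eq_image, Finset.image_image, Finset.image_image]
    rfl
  · exact fun D E h => Or.inl (Finset.disjSum_mono (Finset.image_subset_image h)
      (Finset.image_subset_image h))

/-- A box goes to the simplex of all directed edges from its left shore to its right shore. -/
theorem boxComplexOne_hasZ2Map_boxComplexEdge [Finite V] :
    G.boxComplexOne.HasZ2Map G.boxComplexEdge := by
  classical
  have := G.finite_dart
  have := Fintype.ofFinite G.Dart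
  refine HasZ2Map.trans (L := G.boxComplexEdge.sd) (hasZ2Map_of_chain_map (fun _ h => h.2)
    (fun _ h₁ h₂ => ⟨h₁, h₂⟩)
    (fun S => ⟨Finset.univ.filter fun d : G.Dart => d.fst ∈ S.1.toLeft ∧ d.snd ∈ S.1.toRight,
      ?_, S.1.toLeft, S.1.toRight, S.2.2.1, S.2.2.2.1, S.2.2.2.2,
      fun d hd => (Finset.mem_filter.1 hd).2⟩) ?_ ?_) G.boxComplexEdge.sd_hasZ2Map
  · obtain ⟨-, ⟨a, ha⟩, ⟨b, hb⟩, h⟩ := S.2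
    exact ⟨⟨(a, b), h.2 a ha b hb⟩, Finset.mem_filter.2 ⟨Finset.mem_univ _, ha, hb⟩⟩
  · intro S
    refine Subtype.ext (Finset.ext fun d => ?_)
    rw [coe_sd_swap, Finset.mem_map_equiv, Finset.mem_filter, Finset.mem_filter]
    change _ ∧ d.fst ∈ (swapShores S.1).toLeft ∧ d.snd ∈ (swapShores S.1).toRight ↔
      _ ∧ d.snd ∈ S.1.toLeft ∧ d.fst ∈ S.1.toRight
    rw [toLeft_swapShores, toRight_swapShores, and_comm (a := d.fst ∈ _)]
    simp only [Finset.mem_univ]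
  · intro S T h
    refine Or.inl fun d hd => ?_
    obtain ⟨-, h₁, h₂⟩ := Finset.mem_filter.1 hd
    exact Finset.mem_filter.2 ⟨Finset.mem_univ _, Finset.toLeft_subset_toLeft h h₁,
      Finset.toRight_subset_toRight h h₂⟩

/-- Each nonempty shore consists of common neighbours of the other one. -/
theorem boxComplexOne_hasZ2Map_boxComplex [Finite V] :
    G.boxComplexOne.HasZ2Map G.boxComplex := by
  refine HasZ2Map.trans (pairOrderComplex_hasZ2Map id monotone_id ?_)
    pairOrderComplex_hasZ2Map_pairComplex
  rintro A B hne ⟨hA, hB, h⟩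
  exact ⟨hne, h, Set.Nonempty.mono (isBox_iff_subset_CN.1 h) hB,
    Set.Nonempty.mono (isBox_iff_subset_CN.1 h.symm) hA⟩

theorem boxComplexOne_hasZ2Map_boxComplexZero [Finite V] :
    G.boxComplexOne.HasZ2Map G.boxComplexZero :=
  HasZ2Map.trans (pairOrderComplex_hasZ2Map id monotone_id fun _ _ hne h => ⟨hne, h.2.2⟩)
    pairOrderComplex_hasZ2Map_pairComplex

/-- A pair `A' ⊎ A''` goes to the midpoint of `CN(CN(A')) ⊆ CN(A'')`, where the term of an empty
shore is omitted. -/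
theorem boxComplex_hasZ2Map_lovaszComplex [Finite V] :
    G.boxComplex.HasZ2Map G.lovaszComplex := by
  refine HasZ2Map.trans pairComplex_hasZ2Map_pairOrderComplex (hasZ2Map_of_chain_rel
    (fun _ h => h.2) (fun _ h₁ h₂ => ⟨h₁, h₂⟩)
    (fun S A => (S.1.toLeft.Nonempty ∧ A.1 = G.CN (G.CN S.1.toLeft)) ∨
      (S.1.toRight.Nonempty ∧ A.1 = G.CN S.1.toRight)) ?_ ?_ ?_)
  · rintro S A (⟨h, hA⟩ | ⟨h, hA⟩)
    · change _ ∨ ((swapShores S.1).toRight.Nonempty ∧ G.CN A.1 = G.CN (swapShores S.1).toRight)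
      rw [toRight_swapShores, hA, CN_CN_CN]
      exact Or.inr ⟨h, rfl⟩
    · change ((swapShores S.1).toLeft.Nonempty ∧
        G.CN A.1 = G.CN (G.CN (swapShores S.1).toLeft)) ∨ _
      rw [toLeft_swapShores, hA]
      exact Or.inl ⟨h, rfl⟩
  · rintro ⟨S, hne, -, hA, hB⟩
    rcases toLeft_nonempty_or_toRight_nonempty hne with h | h
    · refine ⟨⟨G.CN (G.CN S.toLeft), ?_, ?_, ?_⟩, Or.inl ⟨h, rfl⟩⟩
      · exact Set.Nonempty.mono (G.subset_CN_CN _) h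
      · rwa [CN_CN_CN]
      · rw [CN_CN_CN]
    · refine ⟨⟨G.CN S.toRight, hB, ?_, G.CN_CN_CN _⟩, Or.inr ⟨h, rfl⟩⟩
      exact Set.Nonempty.mono (G.subset_CN_CN _) h
  · rintro S T hST A B hA hB
    have hl : (S.1.toLeft : Set V) ⊆ T.1.toLeft :=
      Finset.coe_subset.2 (Finset.toLeft_subset_toLeft hST)
    have hr : (S.1.toRight : Set V) ⊆ T.1.toRight :=
      Finset.coe_subset.2 (Finset.toRight_subset_toRight hST)
    -- In the mixed cases only the box property of the larger pair is needed: inclusions of shores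
    -- lead from `S` to `T`, and the two shores of `T` are compared there.
    have hT := isBox_iff_subset_CN.1 T.2.2.1
    change A.1 ⊆ B.1 ∨ B.1 ⊆ A.1
    rcases hA with ⟨-, hA⟩ | ⟨-, hA⟩ <;> rcases hB with ⟨-, hB⟩ | ⟨-, hB⟩ <;> rw [hA, hB]
    · exact Or.inl (G.CN_anti (G.CN_anti hl))
    · exact Or.inl (G.CN_anti (hT.trans (G.CN_anti hl)))
    · exact Or.inr (G.CN_anti (hr.trans hT))
    · exact Or.inr (G.CN_anti hr)

/-- A chain `A₁ ⊂ ⋯ ⊂ Aₖ` goes to the box `A₁ ⊎ CN(Aₖ)`. -/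
theorem lovaszComplex_hasZ2Map_boxComplexOne [Finite V] :
    G.lovaszComplex.HasZ2Map G.boxComplexOne := by
  classical
  have := Fintype.ofFinite V
  -- `lo c` is the intersection of the members of the chain, that is, its least member, and `hi c`
  -- is the set of common neighbours of its greatest member. As intersections over the chain, both
  -- visibly shrink when the chain grows, and applying CN to all members exchanges them.
  let lo : Finset {A : Set V // A.Nonempty ∧ (G.CN A).Nonempty ∧ G.CN (G.CN A) = A} →
    Finset V := fun c => Finset.univ.filter fun v => ∀ A ∈ c, v ∈ A.1
  let hi : Finset {A : Set V // A.Nonempty ∧ (G.CN A).Nonempty ∧ G.CN (G.CN A) = A} →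
    Finset V := fun c => Finset.univ.filter fun v => ∀ A ∈ c, v ∈ G.CN A.1
  have hlo : ∀ c ∈ G.lovaszComplex.faces, (lo c).Nonempty := by
    rintro c ⟨hne, hc⟩
    obtain ⟨m, hm⟩ := c.exists_minimal hne
    obtain ⟨v, hv⟩ := m.2.1
    refine ⟨v, Finset.mem_filter.2 ⟨Finset.mem_univ _, fun A hA => ?_⟩⟩
    rcases hc.total hm.1 hA with h | h
    · exact h hv
    · exact hm.2 hA h hv
  have hhi : ∀ c ∈ G.lovaszComplex.faces, (hi c).Nonempty := by
    rintro c ⟨hne, hc⟩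
    obtain ⟨m, hm⟩ := c.exists_maximal hne
    obtain ⟨v, hv⟩ := m.2.2.1
    refine ⟨v, Finset.mem_filter.2 ⟨Finset.mem_univ _, fun A hA => ?_⟩⟩
    rcases hc.total hA hm.1 with h | h
    · exact G.CN_anti h hv
    · exact G.CN_anti (hm.2 hA h) hv
  refine G.lovaszComplex.hasZ2Map_sd.trans (hasZ2Map_of_chain_map (fun _ h => h.2)
    (fun _ h₁ h₂ => ⟨h₁, h₂⟩)
    (fun c => ⟨(lo c.1).disjSum (hi c.1), disjSum_nonempty (Or.inl (hlo c.1 c.2)), ?_⟩) ?_ ?_)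
  · rw [Finset.toLeft_disjSum, Finset.toRight_disjSum]
    refine ⟨hlo c.1 c.2, hhi c.1 c.2, isBox_iff_subset_CN.2 fun b hb a ha => ?_⟩
    obtain ⟨A, hA⟩ := c.2.1
    exact (Finset.mem_filter.1 hb).2 A hA a ((Finset.mem_filter.1 ha).2 A hA)
  · intro c
    refine Subtype.ext ?_
    refine Eq.trans ?_ (swapShores_disjSum _ _).symm
    change (lo (c.1.map G.lovaszComplex.swap.toEmbedding)).disjSum
      (hi (c.1.map G.lovaszComplex.swap.toEmbedding)) = _
    congr 1
    · ext v
      simp only [lo, hi, Finset.mem_filter, Finset.mem_univ, true_and, Finset.forall_mem_map]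
      rfl
    · ext v
      simp only [lo, hi, Finset.mem_filter, Finset.mem_univ, true_and, Finset.forall_mem_map]
      refine forall₂_congr fun A _ => ?_
      change v ∈ G.CN (G.CN A.1) ↔ _
      rw [A.2.2.2]
  · intro c d h
    -- A longer chain gives a smaller box, so the map reverses order.
    refine Or.inr (Finset.disjSum_mono ?_ ?_)
    · exact Finset.monotone_filter_right _ fun v _ hv A hA => hv A (h hA)
    · exact Finset.monotone_filter_right _ fun v _ hv A hA => hv A (h hA)

end SimpleGraph


/-! ### Kneser representations -/

section Kneser

variable {X V : Type*} {F : Set (Finset X)} {G : SimpleGraph V}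

theorem disjoint_of_adj_kneser (e : G ≃g kneserGraph F) {u v : V} (h : G.Adj u v) :
    Disjoint (e u).1 (e v).1 := (e.map_adj_iff.2 h).2

/-- Disjoint nonempty sets are distinct, so disjointness alone gives an edge of the Kneser graph. -/
theorem adj_of_disjoint_kneser (hF : ∅ ∉ F) (e : G ≃g kneserGraph F) {u v : V}
    (h : Disjoint (e u).1 (e v).1) : G.Adj u v := by
  refine e.map_adj_iff.1 ⟨fun huv => hF ?_, h⟩
  rw [huv, Finset.disjoint_self_iff_empty] at h
  exact h ▸ (e v).2

theorem disjoint_biUnion_of_isBox [DecidableEq X] (e : G ≃g kneserGraph F) {A B : Finset V}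
    (h : G.IsBox A B) : Disjoint (A.biUnion fun v => (e v).1) (B.biUnion fun v => (e v).1) := by
  rw [Finset.disjoint_biUnion_left]
  intro a ha
  rw [Finset.disjoint_biUnion_right]
  exact fun b hb => disjoint_of_adj_kneser e (h.2 a ha b hb)

theorem exists_subset_biUnion [DecidableEq X] (e : G ≃g kneserGraph F) {A : Finset V}
    (h : A.Nonempty) : ∃ C ∈ F, C ⊆ A.biUnion fun v => (e v).1 := by
  obtain ⟨a, ha⟩ := h
  exact ⟨_, (e a).2, Finset.subset_biUnion_of_mem (fun v => (e v).1) ha⟩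

theorem nonempty_of_exists_subset (hF : ∅ ∉ F) {B : Finset X} (h : ∃ C ∈ F, C ⊆ B) :
    B.Nonempty := by
  obtain ⟨C, hC, hCB⟩ := h
  refine Finset.Nonempty.mono hCB (Finset.nonempty_iff_ne_empty.2 fun h0 => hF ?_)
  rwa [← h0]

open Classical in
theorem isBox_filter_subset [Fintype V] (hF : ∅ ∉ F) (e : G ≃g kneserGraph F) {A B : Finset X}
    (h : Disjoint A B) : G.IsBox (Finset.univ.filter fun v => (e v).1 ⊆ A)
      (Finset.univ.filter fun v => (e v).1 ⊆ B) :=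
  G.isBox_iff_subset_CN.2 fun _ hb _ ha => adj_of_disjoint_kneser hF e
    (h.mono (Finset.mem_filter.1 ha).2 (Finset.mem_filter.1 (Finset.mem_coe.1 hb)).2)

open Classical in
theorem filter_subset_nonempty [Fintype V] (e : G ≃g kneserGraph F) {A : Finset X}
    (h : ∃ C ∈ F, C ⊆ A) : (Finset.univ.filter fun v => (e v).1 ⊆ A).Nonempty := by
  obtain ⟨C, hC, hCA⟩ := h
  exact ⟨e.symm ⟨C, hC⟩, Finset.mem_filter.2 ⟨Finset.mem_univ _, by
    rw [RelIso.apply_symm_apply]; exact hCA⟩⟩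

open Classical in
theorem filter_subset_monotone [Fintype V] (e : G ≃g kneserGraph F) :
    Monotone fun A : Finset X => Finset.univ.filter fun v => (e v).1 ⊆ A :=
  fun _ _ hAB => Finset.monotone_filter_right _ fun _ _ hv => hv.trans hAB

variable [Finite X] [Finite V]

/-- Each shore goes to the union of its sets in X; adjacency across a box makes the two unions
disjoint. -/
theorem boxComplexOne_hasZ2Map_kneserBoxComplexOne (hF : ∅ ∉ F) (e : G ≃g kneserGraph F) :
    G.boxComplexOne.HasZ2Map (kneserBoxComplexOne F) := by
  classical
  refine pairOrderComplex_hasZ2Map (fun A => A.biUnion fun v => (e v).1)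
    (fun _ _ h => Finset.biUnion_subset_biUnion_of_subset_left _ h) ?_
  rintro A B - ⟨hA, hB, h⟩
  exact ⟨Or.inl (nonempty_of_exists_subset hF (exists_subset_biUnion e hA)),
    disjoint_biUnion_of_isBox e h, exists_subset_biUnion e hA, exists_subset_biUnion e hB⟩

/-- Each shore goes to all members of `F` that it contains; members inside disjoint shores are
adjacent. -/
theorem kneserBoxComplexOne_hasZ2Map_boxComplexOne (hF : ∅ ∉ F) (e : G ≃g kneserGraph F) :
    (kneserBoxComplexOne F).HasZ2Map G.boxComplexOne := by
  classical
  have := Fintype.ofFinite V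
  refine pairOrderComplex_hasZ2Map _ (filter_subset_monotone e) ?_
  rintro A B - ⟨h, hA, hB⟩
  exact ⟨Or.inl (filter_subset_nonempty e hA), filter_subset_nonempty e hA,
    filter_subset_nonempty e hB, isBox_filter_subset hF e h⟩

theorem boxComplexZero_hasZ2Map_sarkariaComplex (hF : ∅ ∉ F) (e : G ≃g kneserGraph F) :
    G.boxComplexZero.HasZ2Map (sarkariaComplex F) := by
  classical
  refine pairComplex_hasZ2Map_pairOrderComplex.trans
    (pairOrderComplex_hasZ2Map (fun A => A.biUnion fun v => (e v).1)
      (fun _ _ h => Finset.biUnion_subset_biUnion_of_subset_left _ h) ?_)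
  intro A B hne h
  have hsub := hne.imp (exists_subset_biUnion e) (exists_subset_biUnion e)
  exact ⟨hsub.imp (nonempty_of_exists_subset hF) (nonempty_of_exists_subset hF),
    disjoint_biUnion_of_isBox e h, hsub⟩

theorem sarkariaComplex_hasZ2Map_boxComplexZero (hF : ∅ ∉ F) (e : G ≃g kneserGraph F) :
    (sarkariaComplex F).HasZ2Map G.boxComplexZero := by
  classical
  have := Fintype.ofFinite V
  refine HasZ2Map.trans (pairOrderComplex_hasZ2Map _ (filter_subset_monotone e) ?_)
    pairOrderComplex_hasZ2Map_pairComplex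
  rintro A B - ⟨h, hAB⟩
  exact ⟨hAB.imp (filter_subset_nonempty e) (filter_subset_nonempty e),
    isBox_filter_subset hF e h⟩

/-- The pairs with an empty right shore get the sign `1`, those with an empty left shore `-1`. -/
theorem boxComplexZero_ind_le (G : SimpleGraph V) :
    G.boxComplexZero.ind ≤ G.boxComplexOne.ind + 1 := by
  classical
  refine G.boxComplexZero.hasZ2Map_sd.ind_le.trans (ind_le_ind_add_one _ _
    (⟨fun S => ⟨S.1, S.2.1, S.2.2.2.2⟩, fun _ _ h => Subtype.ext (congrArg (fun S => S.1) h)⟩ :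
      _ ↪ {S // S ∈ G.boxComplexZero.faces})
    (fun _ => rfl) ?_
    (fun S => (if S.1.toRight.Nonempty then 0 else 1) - (if S.1.toLeft.Nonempty then 0 else 1))
    ?_ ?_ ?_)
  · rintro s ⟨-, hs⟩ t ht h
    exact ⟨ht, fun S hS T hT hne => hs (h S hS) (h T hT) fun h => hne
      (Subtype.ext (congrArg (fun S => S.1) h))⟩
  · intro S
    have hl : (G.boxComplexZero.sd.swap S).1.toLeft = S.1.toRight := toLeft_swapShores S.1
    have hr : (G.boxComplexZero.sd.swap S).1.toRight = S.1.toLeft := toRight_swapShores S.1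
    simp only [hl, hr, neg_sub]
  · intro S hS
    have hne := toLeft_nonempty_or_toRight_nonempty S.2.1
    have : S.1.toLeft.Nonempty ∧ S.1.toRight.Nonempty := by
      by_cases hl : S.1.toLeft.Nonempty <;> by_cases hr : S.1.toRight.Nonempty <;>
        simp_all
    exact ⟨⟨S.1, S.2.1, this.1, this.2, S.2.2⟩, rfl⟩
  · rintro s ⟨hne, hs⟩
    obtain ⟨m, hm⟩ := s.exists_minimal hne
    have hms : ∀ S ∈ s, m.1 ⊆ S.1 := fun S hS => by
      rcases hs.total hm.1 hS with h | h
      · exact h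
      · exact hm.2 hS h
    -- A shore that is nonempty in the least pair of a chain is nonempty in every pair of it, which
    -- excludes one of the two signs.
    rcases toLeft_nonempty_or_toRight_nonempty m.2.1 with h | h
    · refine Or.inl fun S hS => ?_
      rw [if_pos (h.mono (Finset.toLeft_subset_toLeft (hms S hS)))]
      split_ifs <;> norm_num
    · refine Or.inr fun S hS => ?_
      rw [if_pos (h.mono (Finset.toRight_subset_toRight (hms S hS)))]
      split_ifs <;> norm_num

end Kneser

theorem mainTheorem2 {X V : Type*} [Finite X] [Finite V] (F : Set (Finset X)) (hF : ∅ ∉ F)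
    (G : SimpleGraph V) (e : G ≃g kneserGraph F) (hG : ∀ v, ¬ G.IsIsolated v) :
    G.boxComplexOne.ind = (kneserBoxComplexOne F).ind ∧
    (kneserBoxComplexOne F).ind = G.boxComplexEdge.ind ∧
    G.boxComplexEdge.ind = G.boxComplex.ind ∧
    G.boxComplex.ind = G.lovaszComplex.ind ∧
    G.lovaszComplex.ind ≤ G.boxComplexZero.ind ∧
    G.boxComplexZero.ind = (sarkariaComplex F).ind ∧
    (sarkariaComplex F).ind ≤ G.boxComplexOne.ind + 1 := by
  -- `B₁(G)` serves as the hub: the indices of `B₁(F)`, `B_edge(G)` and `B(G)` are each compared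
  -- with its index.
  have hKneser : G.boxComplexOne.ind = (kneserBoxComplexOne F).ind :=
    (boxComplexOne_hasZ2Map_kneserBoxComplexOne hF e).ind_le.antisymm
      (kneserBoxComplexOne_hasZ2Map_boxComplexOne hF e).ind_le
  have hEdge : G.boxComplexOne.ind = G.boxComplexEdge.ind :=
    G.boxComplexOne_hasZ2Map_boxComplexEdge.ind_le.antisymm
      G.boxComplexEdge_hasZ2Map_boxComplexOne.ind_le
  have hBox : G.boxComplexOne.ind = G.boxComplex.ind :=
    G.boxComplexOne_hasZ2Map_boxComplex.ind_le.antisymm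
      (G.boxComplex_hasZ2Map_lovaszComplex.trans G.lovaszComplex_hasZ2Map_boxComplexOne).ind_le
  have hLovasz : G.boxComplex.ind = G.lovaszComplex.ind :=
    G.boxComplex_hasZ2Map_lovaszComplex.ind_le.antisymm
      (G.lovaszComplex_hasZ2Map_boxComplexOne.trans G.boxComplexOne_hasZ2Map_boxComplex).ind_le
  have hSark : G.boxComplexZero.ind = (sarkariaComplex F).ind :=
    (boxComplexZero_hasZ2Map_sarkariaComplex hF e).ind_le.antisymm
      (sarkariaComplex_hasZ2Map_boxComplexZero hF e).ind_le
  exact ⟨hKneser, hKneser.symm.trans hEdge, hEdge.symm.trans hBox, hLovasz,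
    (G.lovaszComplex_hasZ2Map_boxComplexOne.trans
      G.boxComplexOne_hasZ2Map_boxComplexZero).ind_le, hSark,
    hSark ▸ boxComplexZero_ind_le G⟩
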